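/- Let $n\ge 1$ and let $f=(f_1,\dots,f_n)$ be polynomials in $X_1,\dots,X_n$ with non-negative real coefficients and total degree at most $2$. Assume that * $f$ is feasible: $f(y)=y$ for some $y\in\mathbb{R}_{\ge 0}^n$; then $f$ has a (componentwise) least fixed point $\mu f$ in $\mathbb{R}_{\ge 0}^n$; * $f$ is clean: for every $j$ there is a $k\in\mathbb{N}$ with $(f^k(0))_j>0$, where $f^k$ is the $k$-fold iterate of $f$; * $f$ is strongly connected: for all $j,l$, the pair $(j,l)$ lies in the reflexive transitive closure of the relation "$\partial f_j/\partial X_l$ is not the zero polynomial". Let $c_{\min}$ be the smallest nonzero coefficient of $f$, let $\mu_{\min}$ and $\mu_{\max}$ be the smallest and the largest component of $\mu f$, and put $$k_f = n\cdot\log_2\left(\frac{\mu_{\max}}{c_{\min}\cdot\mu_{\min}\cdot\min\{\mu_{\min},1\}}\right).$$ Let $\nu^{(0)}=0$ and $\nu^{(k+1)}=\nu^{(k)}+(\mathrm{Id}-f'(\nu^{(k)}))^{-1}\bigl(f(\nu^{(k)})-\nu^{(k)}\bigr)$ be the Newton sequence, where $f'$ is the Jacobian matrix of $f$. Then the Newton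 sequence is well defined, i.e. all the matrices $\mathrm{Id}-f'(\nu^{(k)})$ are invertible, and for every integer $i\ge 0$ the iterate $\nu^{(\max\{\lceil k_f\rceil,0\}+i)}$ has at least $i$ valid bits of $\mu f$, that is, $$\frac{|(\mu f)_j-\nu^{(\max\{\lceil k_f\rceil,0\}+i)}_j|}{|(\mu f)_j|}\le 2^{-i}\qquad\text{for every } 1\le j\le n.$$ -/

import Mathlib

namespace MSP

/-- A system `f = (f₁, …, fₙ)` of real polynomials in the variables `X₁, …, Xₙ`. -/
abbrev PolySystem (n : ℕ) := Fin n → MvPolynomial (Fin n) ℝ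

variable {n : ℕ}

/-- The value `f(x)` of the system at a vector `x`. -/
noncomputable def value (f : PolySystem n) (x : Fin n → ℝ) : Fin n → ℝ :=
  fun i => MvPolynomial.eval x (f i)

/-- All coefficients are non-negative. -/
def NonnegCoeffs (f : PolySystem n) : Prop :=
  ∀ i d, 0 ≤ MvPolynomial.coeff d (f i)

/-- The fixed points of `f` in the non-negative orthant. -/
def fixedPoints (f : PolySystem n) : Set (Fin n → ℝ) :=
  {y | 0 ≤ y ∧ value f y = y}

/-- The system has a non-negative fixed point. -/
def Feasible (f : PolySystem n) : Prop := (fixedPoints f).Nonempty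

/-- The Kleene sequence `κ⁰ = 0`, `κᵏ⁺¹ = f(κᵏ)`. -/
noncomputable def kleene (f : PolySystem n) (k : ℕ) : Fin n → ℝ := (value f)^[k] 0

/-- Every variable is productive: some Kleene iterate is positive in that component. -/
def Clean (f : PolySystem n) : Prop := ∀ i, ∃ k, 0 < kleene f k i

/-- A monotone system of polynomials, by convention clean and feasible. -/
structure IsMSP (f : PolySystem n) : Prop where
  nonneg : NonnegCoeffs f
  clean : Clean f
  feasible : Feasible f

/-- All monomials have degree at most `2`. -/
def Quadratic (f : PolySystem n) : Prop := ∀ i, (f i).totalDegree ≤ 2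

/-- `X_i` depends directly on `X_k`: the polynomial `∂f_i/∂X_k` is not zero. -/
def DependsDirectly (f : PolySystem n) (i k : Fin n) : Prop :=
  MvPolynomial.pderiv k (f i) ≠ 0

/-- All variables depend on each other, where dependence is the reflexive transitive closure
of direct dependence. -/
def StronglyConnected (f : PolySystem n) : Prop :=
  ∀ i k, Relation.ReflTransGen (DependsDirectly f) i k

/-- The Jacobian matrix `f'(x)`. -/
noncomputable def jacobian (f : PolySystem n) (x : Fin n → ℝ) : Matrix (Fin n) (Fin n) ℝ :=
  Matrix.of fun i j => MvPolynomial.eval x (MvPolynomial.pderiv j (f i))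

/-- The Newton operator `x ↦ x + (Id - f'(x))⁻¹ (f(x) - x)`
(meaningful where `Id - f'(x)` is invertible). -/
noncomputable def newtonOp (f : PolySystem n) (x : Fin n → ℝ) : Fin n → ℝ :=
  x + Matrix.mulVec (1 - jacobian f x)⁻¹ (value f x - x)

/-- The Newton sequence `ν⁰ = 0`, `νᵏ⁺¹ = N_f(νᵏ)`. -/
noncomputable def newton (f : PolySystem n) (k : ℕ) : Fin n → ℝ := (newtonOp f)^[k] 0

/-- The least fixed point `μf`, as the (componentwise) infimum of the non-negative fixed points.
It is the least element of that set by `lfp_isLeast`. -/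
noncomputable def lfp (f : PolySystem n) : Fin n → ℝ := sInf (fixedPoints f)

/-- The smallest nonzero coefficient (the set is finite, and nonempty if some `f_i` is nonzero). -/
noncomputable def cMin (f : PolySystem n) : ℝ :=
  sInf {c | c ≠ 0 ∧ ∃ i d, MvPolynomial.coeff d (f i) = c}

/-- The smallest component of `μf` (for `n ≥ 1`). -/
noncomputable def muMin (f : PolySystem n) : ℝ := ⨅ i, lfp f i

/-- The largest component of `μf` (for `n ≥ 1`). -/
noncomputable def muMax (f : PolySystem n) : ℝ := ⨆ i, lfp f i

/-- `k_f = n · log₂ (μ_max / (c_min · μ_min · min {μ_min, 1}))`. -/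
noncomputable def threshold (f : PolySystem n) : ℝ :=
  n * Real.logb 2 (muMax f / (cMin f * muMin f * min (muMin f) 1))

/-- The vector `ν` has (at least) `i` valid bits of `μ`. -/
def HasValidBits (i : ℕ) (μ ν : Fin n → ℝ) : Prop :=
  ∀ j, |μ j - ν j| / |μ j| ≤ (2 : ℝ) ^ (-(i : ℤ))

theorem value_mono {f : PolySystem n} (hf : NonnegCoeffs f) {x y : Fin n → ℝ}
    (hx : 0 ≤ x) (hxy : x ≤ y) : value f x ≤ value f y := by
  intro i
  simp only [value, MvPolynomial.eval_eq]
  refine Finset.sum_le_sum fun d _ => mul_le_mul_of_nonneg_left ?_ (hf i d)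
  exact Finset.prod_le_prod (fun j _ => pow_nonneg (hx j) _)
    (fun j _ => pow_le_pow_left₀ (hx j) (hxy j) _)

theorem value_nonneg {f : PolySystem n} (hf : NonnegCoeffs f) {x : Fin n → ℝ}
    (hx : 0 ≤ x) : 0 ≤ value f x := by
  intro i
  simp only [value, MvPolynomial.eval_eq]
  exact Finset.sum_nonneg fun d _ => mul_nonneg (hf i d)
    (Finset.prod_nonneg fun j _ => pow_nonneg (hx j) _)

theorem kleene_succ (f : PolySystem n) (k : ℕ) : kleene f (k + 1) = value f (kleene f k) := by
  simp [kleene, Function.iterate_succ_apply']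

/-- A feasible system with non-negative coefficients has a least fixed point, and it is `lfp f`. -/
theorem lfp_isLeast {f : PolySystem n} (hf : NonnegCoeffs f) (h : Feasible f) :
    IsLeast (fixedPoints f) (lfp f) := by
  have h0 : ∀ k, 0 ≤ kleene f k := by
    intro k
    induction k with
    | zero => exact le_refl _
    | succ k ih => rw [kleene_succ]; exact value_nonneg hf ih
  have hm : Monotone (kleene f) := by
    refine monotone_nat_of_le_succ fun k => ?_
    induction k with
    | zero => exact h0 1
    | succ k ih =>
      rw [kleene_succ f (k + 1)]
      nth_rewrite 1 [kleene_succ f k]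
      exact value_mono hf (h0 k) ih
  have hle : ∀ y ∈ fixedPoints f, ∀ k, kleene f k ≤ y := by
    intro y hy k
    induction k with
    | zero => exact hy.1
    | succ k ih =>
      rw [kleene_succ, ← hy.2]
      exact value_mono hf (h0 k) ih
  obtain ⟨y, hy⟩ := h
  have hb : BddAbove (Set.range (kleene f)) :=
    ⟨y, by rintro _ ⟨k, rfl⟩; exact hle y hy k⟩
  have ht := tendsto_atTop_ciSup hm hb
  have hc : Continuous (value f) :=
    continuous_pi fun i => MvPolynomial.continuous_eval (f i)
  have ht' := (hc.tendsto _).comp ht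
  have ht2 := (Filter.tendsto_add_atTop_iff_nat 1).2 ht
  have hfix : value f (⨆ k, kleene f k) = ⨆ k, kleene f k := by
    refine tendsto_nhds_unique ht' ?_
    convert ht2 using 1
    funext k
    exact (kleene_succ f k).symm
  have hL : IsLeast (fixedPoints f) (⨆ k, kleene f k) :=
    ⟨⟨le_ciSup hb 0, hfix⟩, fun z hz => ciSup_le (hle z hz)⟩
  have : lfp f = ⨆ k, kleene f k := hL.csInf_eq
  rw [this]
  exact hL

end MSP

/-! ### Exact second order expansion of quadratic polynomials. -/

open MvPolynomial
namespace MSP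
variable {n : ℕ}

/-! Write μ for the least fixed point and B for the symmetric non-negative bilinear part of f.
Taylor expansion is exact: f(x + e) = f(x) + f'(x)e + B(e, e) and f'(x + e)d = f'(x)d + 2B(e, d).
Well-definedness rests on Id - f'(x) having a non-negative inverse at the iterates
(`isInverseNonneg_jacobian_of_lt_lfp`). The test vector μ - x is a supersolution there, and strong
connectivity supplies the needed strictness.

The Newton error satisfies (Id - f'(x))(μ - N(x)) = B(μ - x, μ - x). If d > 0 is a cone vector,
f'(μ)d ≤ d, and μ - x ≤ c d, comparing with f'(μ)d = f'(x)d + 2B(μ - x, d) gives μ - N(x) ≤ (c/2) d.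
So the error halves at each step from the start (`sub_newton_le`). A cone vector arises as a limit
of normalised Newton errors (`exists_cone_vector`).

The threshold pays for comparing d with μ. The nonzero entries of f'(μ) are at least q = c_min
min{μ_min, 1}, and dependence paths have length at most n - 1, so components of d differ by at most
q^{-(n-1)}, while those of μ differ by at most μ_max/μ_min. -/

theorem exists_single_add_of_ne_zero {d : Fin n →₀ ℕ} (hd : d ≠ 0) :
    ∃ j d', d = Finsupp.single j 1 + d' := by
  obtain ⟨j, hj⟩ := Finsupp.ne_iff.1 hd
  refine ⟨j, d - Finsupp.single j 1, ?_⟩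
  rw [add_tsub_cancel_of_le]
  rw [Finsupp.single_le_iff]
  exact Nat.one_le_iff_ne_zero.2 hj

/-- `Q` is the symmetric non-negative matrix of the second order part of `p`, and the Taylor
expansions of `p` and of its partial derivatives at every point are exact with it. -/
structure IsSecondOrder (p : MvPolynomial (Fin n) ℝ) (Q : Fin n → Fin n → ℝ) : Prop where
  nonneg : ∀ j k, 0 ≤ Q j k
  symm : ∀ j k, Q j k = Q k j
  eval_add : ∀ x e, eval (x + e) p =
    eval x p + ∑ j, eval x (pderiv j p) * e j + ∑ j, ∑ k, Q j k * e j * e k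
  eval_pderiv_add : ∀ x e j, eval (x + e) (pderiv j p) =
    eval x (pderiv j p) + 2 * ∑ k, Q j k * e k

theorem IsSecondOrder.add {p p' : MvPolynomial (Fin n) ℝ} {Q Q' : Fin n → Fin n → ℝ}
    (h : IsSecondOrder p Q) (h' : IsSecondOrder p' Q') :
    IsSecondOrder (p + p') fun j k => Q j k + Q' j k where
  nonneg j k := add_nonneg (h.nonneg j k) (h'.nonneg j k)
  symm j k := by rw [h.symm, h'.symm]
  eval_add x e := by
    simp only [map_add, h.eval_add, h'.eval_add, add_mul, Finset.sum_add_distrib]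
    ring
  eval_pderiv_add x e j := by
    simp only [map_add, h.eval_pderiv_add, h'.eval_pderiv_add, add_mul, Finset.sum_add_distrib]
    ring

theorem exists_isSecondOrder_monomial {d : Fin n →₀ ℕ} (hd : d.degree ≤ 2) {c : ℝ}
    (hc : 0 ≤ c) : ∃ Q, IsSecondOrder (monomial d c) Q := by
  by_cases h0 : d = 0
  · subst h0
    refine ⟨fun _ _ => 0, fun _ _ => le_rfl, fun _ _ => rfl, ?_, ?_⟩ <;> intros <;> simp
  obtain ⟨j, d', rfl⟩ := exists_single_add_of_ne_zero h0
  by_cases h1 : d' = 0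
  · subst h1
    have : monomial (Finsupp.single j 1 + 0) c = C c * (X j : MvPolynomial (Fin n) ℝ) := by
      simp [C_mul_X_eq_monomial]
    rw [this]
    refine ⟨fun _ _ => 0, fun _ _ => le_rfl, fun _ _ => rfl, ?_, ?_⟩
    · intro x e
      simp [pderiv_X, Pi.single_apply, apply_ite, mul_add]
    · intro x e l
      by_cases h : l = j <;> simp [pderiv_X, h]
  obtain ⟨k, d'', rfl⟩ := exists_single_add_of_ne_zero h1
  have h2 : d'' = 0 := by
    have : d''.degree = 0 := by
      simp only [map_add, Finsupp.degree_single] at hd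
      omega
    exact (Finsupp.degree_eq_zero_iff _).1 this
  subst h2
  have : monomial (Finsupp.single j 1 + (Finsupp.single k 1 + 0)) c =
      C c * ((X j : MvPolynomial (Fin n) ℝ) * X k) := by
    rw [add_zero, X, X, monomial_mul, C_mul_monomial]
    simp
  rw [this]
  let δ (m l : Fin n) : ℝ := (Pi.single m 1 : Fin n → ℝ) l
  have hs : ∀ (m : Fin n) (g : Fin n → ℝ), ∑ a, δ m a * g a = g m := by
    intro m g
    simp [δ, Pi.single_apply]
  have hd : ∀ (x : Fin n → ℝ) (l : Fin n),
      eval x (pderiv l (C c * ((X j : MvPolynomial (Fin n) ℝ) * X k))) =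
      δ j l * (c * x k) + δ k l * (c * x j) := by
    intro x l
    simp only [pderiv_X, Derivation.leibniz, pderiv_C, smul_eq_mul, map_add, map_mul, eval_C,
      eval_X, δ, Pi.single_apply, apply_ite, map_one, map_zero, eq_comm (a := l)]
    split_ifs <;> ring
  -- The symmetrised matrix of c X_j X_k; for j = k the two terms add up to the coefficient c of the
  -- square.
  refine ⟨fun a b => c / 2 * (δ j a * δ k b +
    δ k a * δ j b), ?_, ?_, ?_, ?_⟩
  · intro a b
    have h1 : ∀ m l : Fin n, 0 ≤ δ m l := by
      intro m l
      simp only [δ, Pi.single_apply]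
      positivity
    have := h1 j a
    have := h1 k b
    have := h1 k a
    have := h1 j b
    positivity
  · intro a b
    ring
  · intro x e
    have hQ : ∑ a, ∑ b, c / 2 * (δ j a * δ k b +
        δ k a * δ j b) * e a * e b = c * e j * e k := by
      calc _ = ∑ a, (δ j a * (c / 2 * e a * ∑ b, δ k b * e b) +
            δ k a * (c / 2 * e a * ∑ b, δ j b * e b)) := by
            refine Finset.sum_congr rfl fun a _ => ?_
            simp only [Finset.mul_sum, ← Finset.sum_add_distrib]
            exact Finset.sum_congr rfl fun b _ => by ring
        _ = c * e j * e k := by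
            rw [Finset.sum_add_distrib, hs, hs, hs, hs]
            ring
    simp only [hd, hQ]
    simp only [add_mul, mul_assoc, Finset.sum_add_distrib, hs]
    simp
    ring
  · intro x e l
    have hQ : ∑ b, c / 2 * (δ j l * δ k b +
        δ k l * δ j b) * e b =
        c / 2 * (δ j l * e k + δ k l * e j) := by
      calc _ = c / 2 * δ j l * (∑ b, δ k b * e b) +
            c / 2 * δ k l * ∑ b, δ j b * e b := by
            simp only [Finset.mul_sum, ← Finset.sum_add_distrib]
            exact Finset.sum_congr rfl fun b _ => by ring
        _ = _ := by
            rw [hs, hs]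
            ring
    rw [hQ, hd, hd]
    simp only [Pi.add_apply]
    ring

theorem exists_isSecondOrder {p : MvPolynomial (Fin n) ℝ} (hp : ∀ d, 0 ≤ coeff d p)
    (hdeg : p.totalDegree ≤ 2) : ∃ Q, IsSecondOrder p Q := by
  -- Induction over subsets of the support keeps the sign and the degree bound of every monomial
  -- available.
  have key : ∀ s ⊆ p.support, ∃ Q, IsSecondOrder (∑ d ∈ s, monomial d (coeff d p)) Q := by
    intro s
    induction s using Finset.induction_on with
    | empty =>
      intro _
      refine ⟨fun _ _ => 0, fun _ _ => le_rfl, fun _ _ => rfl, ?_, ?_⟩ <;> intros <;> simp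
    | insert d s hds ih =>
      intro hs
      rw [Finset.sum_insert hds]
      obtain ⟨Q, hQ⟩ := ih ((Finset.subset_insert d s).trans hs)
      obtain ⟨Q', hQ'⟩ := exists_isSecondOrder_monomial (d := d) (c := coeff d p)
        ((le_totalDegree (hs (Finset.mem_insert_self d s))).trans hdeg) (hp d)
      exact ⟨_, hQ'.add hQ⟩
  obtain ⟨Q, hQ⟩ := key p.support subset_rfl
  rw [support_sum_monomial_coeff] at hQ
  exact ⟨Q, hQ⟩

/-! ### Bounds for coefficients and Jacobian entries. -/

theorem coeff_pderiv_nonneg {p : MvPolynomial (Fin n) ℝ} (hp : ∀ d, 0 ≤ coeff d p)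
    (l : Fin n) (m : Fin n →₀ ℕ) : 0 ≤ coeff m (pderiv l p) := by
  rw [coeff_pderiv]
  exact mul_nonneg (hp _) (by positivity)

theorem jacobian_nonneg {f : PolySystem n} (hf : NonnegCoeffs f) {x : Fin n → ℝ} (hx : 0 ≤ x)
    (i j : Fin n) : 0 ≤ jacobian f x i j := by
  simp only [jacobian, Matrix.of_apply, MvPolynomial.eval_eq]
  exact Finset.sum_nonneg fun d _ => mul_nonneg (coeff_pderiv_nonneg (hf i) j d)
    (Finset.prod_nonneg fun k _ => pow_nonneg (hx k) _)

theorem cMin_set_finite (f : PolySystem n) :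
    {c | c ≠ 0 ∧ ∃ i d, MvPolynomial.coeff d (f i) = c}.Finite := by
  refine (Finset.finite_toSet (Finset.univ.biUnion fun i =>
    (f i).support.image fun d => coeff d (f i))).subset ?_
  rintro _ ⟨hc, i, d, rfl⟩
  simp only [Finset.coe_biUnion, Set.mem_iUnion, Finset.coe_image]
  exact ⟨i, Finset.mem_coe.2 (Finset.mem_univ i), d, Finset.mem_coe.2 (mem_support_iff.2 hc), rfl⟩

theorem cMin_le {f : PolySystem n} {i : Fin n} {d : Fin n →₀ ℕ} (h : coeff d (f i) ≠ 0) :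
    cMin f ≤ coeff d (f i) :=
  csInf_le (cMin_set_finite f).bddBelow ⟨h, i, d, rfl⟩

theorem cMin_pos {f : PolySystem n} (hf : NonnegCoeffs f) {i : Fin n} (hi : f i ≠ 0) :
    0 < cMin f := by
  obtain ⟨d, hd⟩ := MvPolynomial.ne_zero_iff.1 hi
  obtain ⟨h0, j, m, hjm⟩ := Set.Nonempty.csInf_mem
    (s := {c | c ≠ 0 ∧ ∃ i d, MvPolynomial.coeff d (f i) = c})
    ⟨coeff d (f i), hd, i, d, rfl⟩ (cMin_set_finite f)
  change coeff m (f j) = cMin f at hjm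
  exact lt_of_le_of_ne (hjm ▸ hf j m) (Ne.symm h0)

/-- A derivative of a quadratic system that is not identically zero is bounded below. -/
theorem cMin_mul_min_le_jacobian {f : PolySystem n} (hf : NonnegCoeffs f) (hq : Quadratic f)
    {i l : Fin n} (h : DependsDirectly f i l) {x : Fin n → ℝ} {m : ℝ} (hm : 0 ≤ m)
    (hx : ∀ j, m ≤ x j) : cMin f * min m 1 ≤ jacobian f x i l := by
  obtain ⟨d, hd⟩ := MvPolynomial.ne_zero_iff.1 h
  have hx0 : 0 ≤ x := fun j => hm.trans (hx j)
  have hc : coeff (d + Finsupp.single l 1) (f i) ≠ 0 := by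
    rw [coeff_pderiv] at hd
    exact left_ne_zero_of_mul hd
  have hdeg : d.degree ≤ 1 := by
    have := (le_totalDegree (mem_support_iff.2 hc)).trans (hq i)
    change (d + Finsupp.single l 1).degree ≤ 2 at this
    rw [map_add, Finsupp.degree_single] at this
    omega
  -- A monomial of the derivative has degree at most 1, so it is 1 or a single variable.
  have hmon : min m 1 ≤ ∏ j ∈ d.support, x j ^ d j := by
    by_cases h0 : d = 0
    · simp [h0]
    · obtain ⟨j, d', rfl⟩ := exists_single_add_of_ne_zero h0
      have : d' = 0 := by
        rw [map_add, Finsupp.degree_single] at hdeg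
        have : d'.degree = 0 := by omega
        exact (Finsupp.degree_eq_zero_iff _).1 this
      subst this
      rw [add_zero, Finsupp.support_single _ one_ne_zero]
      simpa using Or.inl (hx j)
  calc cMin f * min m 1 ≤ coeff (d + Finsupp.single l 1) (f i) * min m 1 :=
        mul_le_mul_of_nonneg_right (cMin_le hc) (le_min hm zero_le_one)
    _ ≤ coeff d (pderiv l (f i)) * min m 1 := by
        refine mul_le_mul_of_nonneg_right ?_ (le_min hm zero_le_one)
        rw [coeff_pderiv]
        exact le_mul_of_one_le_right (hf _ _) (by simp)
    _ ≤ coeff d (pderiv l (f i)) * ∏ j ∈ d.support, x j ^ d j :=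
        mul_le_mul_of_nonneg_left hmon (coeff_pderiv_nonneg (hf i) l d)
    _ ≤ jacobian f x i l := by
        simp only [jacobian, Matrix.of_apply, MvPolynomial.eval_eq]
        exact Finset.single_le_sum
          (f := fun d => coeff d (pderiv l (f i)) * ∏ j ∈ d.support, x j ^ d j)
          (fun d _ => mul_nonneg (coeff_pderiv_nonneg (hf i) l d)
            (Finset.prod_nonneg fun k _ => pow_nonneg (hx0 k) _)) (mem_support_iff.2 hd)

end MSP
-- Non-negative inverses and irreducibility.
namespace MSP
variable {n : ℕ}

/-- `1 - A` reflects non-negativity, that is, it is injective with a non-negative inverse. -/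
def IsInverseNonneg (A : Matrix (Fin n) (Fin n) ℝ) : Prop := ∀ w, A.mulVec w ≤ w → 0 ≤ w

/-- A kernel vector of 1 - A and its negative are both non-negative. -/
theorem IsInverseNonneg.isUnit_det {A : Matrix (Fin n) (Fin n) ℝ} (hA : IsInverseNonneg A) :
    IsUnit (1 - A).det := by
  rw [← Matrix.isUnit_iff_isUnit_det, ← Matrix.mulVec_injective_iff_isUnit]
  intro u v huv
  simp only [Matrix.sub_mulVec, Matrix.one_mulVec] at huv
  have h : A.mulVec (u - v) = u - v := by
    rw [Matrix.mulVec_sub]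
    linear_combination (exp := 1) -huv
  have h1 := hA _ h.le
  have h2 := hA (-(u - v)) (by rw [Matrix.mulVec_neg, h])
  have h3 : u - v = 0 := le_antisymm (neg_nonneg.1 h2) h1
  exact sub_eq_zero.1 h3

theorem mulVec_mono {A : Matrix (Fin n) (Fin n) ℝ} (hA : ∀ i j, 0 ≤ A i j) {u v : Fin n → ℝ}
    (h : u ≤ v) : A.mulVec u ≤ A.mulVec v := by
  intro i
  simp only [Matrix.mulVec, dotProduct]
  exact Finset.sum_le_sum fun j _ => mul_le_mul_of_nonneg_left (h j) (hA i j)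

/-- The form in which strong connectivity enters all later arguments. -/
theorem StronglyConnected.forall_of_closed {f : PolySystem n} (hsc : StronglyConnected f)
    {p : Fin n → Prop} (hp : ∀ i, p i → ∀ l, DependsDirectly f i l → p l) {i : Fin n}
    (hi : p i) (l : Fin n) : p l := by
  induction hsc i l with
  | refl => exact hi
  | tail _ h ih => exact hp _ ih _ h

/-- A non-negative supersolution of an irreducible system is positive or zero. -/
theorem StronglyConnected.pos_or_eq_zero {f : PolySystem n} (hsc : StronglyConnected f)
    {A : Matrix (Fin n) (Fin n) ℝ} (hA : ∀ i j, 0 ≤ A i j) {y : Fin n → ℝ} (hy : 0 ≤ y)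
    (hAy : A.mulVec y ≤ y)
    (hdep : ∀ i, y i = 0 → ∀ l, DependsDirectly f i l → 0 < A i l) :
    (∀ i, 0 < y i) ∨ y = 0 := by
  by_cases h : ∃ i, y i = 0
  · obtain ⟨i, hi⟩ := h
    right
    funext l
    refine hsc.forall_of_closed (p := fun i => y i = 0) ?_ hi l
    intro i hi l hl
    -- Row i of A y ≤ y with y i = 0 is a vanishing sum of non-negative terms, so zeros spread along
    -- dependence.
    have h1 : A i l * y l ≤ 0 := by
      refine le_trans ?_ ((hAy i).trans hi.le)
      exact Finset.single_le_sum (f := fun j => A i j * y j)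
        (fun j _ => mul_nonneg (hA i j) (hy j)) (Finset.mem_univ l)
    have h2 := hdep i hi l hl
    exact le_antisymm (nonpos_of_mul_nonpos_right h1 h2) (hy l)
  · push Not at h
    exact Or.inl fun i => lt_of_le_of_ne (hy i) (h i).symm

/-- If w has a negative entry, add the least multiple t v that makes y = w + t v non-negative, so y
has a zero. Since A y + t (v - A v) ≤ y, a zero of y forces equality in that row of A v ≤ v. There
the entries of A along dependences are positive, hence y = 0, and then A v = v everywhere. -/
theorem StronglyConnected.isInverseNonneg {f : PolySystem n} (hsc : StronglyConnected f)
    {A : Matrix (Fin n) (Fin n) ℝ} (hA : ∀ i j, 0 ≤ A i j) {v : Fin n → ℝ}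
    (hv : ∀ i, 0 < v i) (hAv : A.mulVec v ≤ v) (hne : A.mulVec v ≠ v)
    (hdep : ∀ i, A.mulVec v i = v i → ∀ l, DependsDirectly f i l → 0 < A i l) :
    IsInverseNonneg A := by
  intro w hw
  by_contra hneg
  obtain ⟨i₀, hi₀⟩ : ∃ i, w i < 0 := by
    by_contra! h
    exact hneg h
  obtain ⟨i, -, hi⟩ := Finset.exists_max_image Finset.univ (fun i => -w i / v i)
    ⟨i₀, Finset.mem_univ i₀⟩
  set t := -w i / v i with ht
  have ht0 : 0 < t := lt_of_lt_of_le (div_pos (neg_pos.2 hi₀) (hv i₀)) (hi i₀ (Finset.mem_univ _))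
  have hy : 0 ≤ w + t • v := fun l => by
    have := hi l (Finset.mem_univ _)
    rw [div_le_iff₀ (hv l)] at this
    simp only [Pi.zero_apply, Pi.add_apply, Pi.smul_apply, smul_eq_mul]
    linarith
  have hyi : (w + t • v) i = 0 := by
    simp only [Pi.add_apply, Pi.smul_apply, smul_eq_mul, ht]
    rw [div_mul_cancel₀ _ (hv i).ne']
    ring
  have hle : ∀ l, A.mulVec (w + t • v) l + t * (v l - A.mulVec v l) ≤ (w + t • v) l := by
    intro l
    have := hw l
    rw [Matrix.mulVec_add, Matrix.mulVec_smul]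
    simp only [Pi.add_apply, Pi.smul_apply, smul_eq_mul]
    linarith
  have hAy0 : ∀ l, 0 ≤ A.mulVec (w + t • v) l := by
    have := mulVec_mono hA hy
    rwa [Matrix.mulVec_zero] at this
  have heq : ∀ l, (w + t • v) l = 0 → A.mulVec v l = v l := by
    intro l hl
    have h1 := hle l
    have h2 := hAy0 l
    rw [hl] at h1
    have h3 : t * (v l - A.mulVec v l) ≤ 0 := by linarith
    have h4 := nonpos_of_mul_nonpos_right h3 ht0
    exact le_antisymm (hAv l) (by linarith)
  have hAy : A.mulVec (w + t • v) ≤ w + t • v := by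
    intro l
    have := hle l
    have := mul_nonneg ht0.le (sub_nonneg.2 (hAv l))
    linarith
  rcases hsc.pos_or_eq_zero hA hy hAy (fun l hl => hdep l (heq l hl)) with h | h
  · exact absurd hyi (h i).ne'
  · exact hne (funext fun l => heq l (congrFun h l))

/-- The vector of the bilinear forms with matrices `Q i`. -/
def bilinForm (Q : Fin n → Fin n → Fin n → ℝ) (u v : Fin n → ℝ) : Fin n → ℝ :=
  fun i => ∑ j, ∑ k, Q i j k * u j * v k

/-- `Q` collects the second order parts of the components of `f`. -/
def HasSecondOrder (f : PolySystem n) (Q : Fin n → Fin n → Fin n → ℝ) : Prop :=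
  ∀ i, IsSecondOrder (f i) (Q i)

theorem exists_hasSecondOrder {f : PolySystem n} (hf : NonnegCoeffs f) (hq : Quadratic f) :
    ∃ Q, HasSecondOrder f Q := by
  choose Q hQ using fun i => exists_isSecondOrder (hf i) (hq i)
  exact ⟨Q, hQ⟩

/-! ### The expansion in vector form. -/

namespace HasSecondOrder

variable {f : PolySystem n} {Q : Fin n → Fin n → Fin n → ℝ}

theorem value_add (hQ : HasSecondOrder f Q) (x e : Fin n → ℝ) :
    value f (x + e) = value f x + (jacobian f x).mulVec e + bilinForm Q e e :=
  funext fun i => (hQ i).eval_add x e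

/-- The factor 2, against the factor 1 in `value_add`, is the source of the halving of the error. -/
theorem jacobian_add_mulVec (hQ : HasSecondOrder f Q) (x e d : Fin n → ℝ) :
    (jacobian f (x + e)).mulVec d = (jacobian f x).mulVec d + (2 : ℝ) • bilinForm Q e d := by
  funext i
  have h1 : bilinForm Q e d i = ∑ j, (∑ k, Q i j k * e k) * d j := by
    rw [bilinForm, Finset.sum_comm]
    refine Finset.sum_congr rfl fun j _ => ?_
    rw [Finset.sum_mul]
    exact Finset.sum_congr rfl fun k _ => by rw [(hQ i).symm]
  simp only [Pi.add_apply, Pi.smul_apply, h1, smul_eq_mul, Finset.mul_sum, Matrix.mulVec,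
    dotProduct, ← Finset.sum_add_distrib]
  refine Finset.sum_congr rfl fun j _ => ?_
  simp only [jacobian, Matrix.of_apply, (hQ i).eval_pderiv_add]
  ring

/-- Lets positivity of the entries in an affine row, known at the positive point `lfp f`, pass to
iterates with zero components. -/
theorem jacobian_eq_of_eq_zero (hQ : HasSecondOrder f Q) {i : Fin n}
    (hi : ∀ j k, Q i j k = 0) (x y : Fin n → ℝ) (l : Fin n) :
    jacobian f x i l = jacobian f y i l := by
  have := (hQ i).eval_pderiv_add x (y - x) l
  rw [add_sub_cancel] at this
  simp [jacobian, this, hi]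

theorem bilinForm_nonneg (hQ : HasSecondOrder f Q) {u v : Fin n → ℝ} (hu : 0 ≤ u) (hv : 0 ≤ v) :
    0 ≤ bilinForm Q u v := fun i =>
  Finset.sum_nonneg fun j _ => Finset.sum_nonneg fun k _ =>
    mul_nonneg (mul_nonneg ((hQ i).nonneg j k) (hu j)) (hv k)

theorem bilinForm_le_smul (hQ : HasSecondOrder f Q) {u v w : Fin n → ℝ} {c : ℝ} (hu : 0 ≤ u)
    (hvw : v ≤ c • w) : bilinForm Q u v ≤ c • bilinForm Q u w := by
  intro i
  simp only [bilinForm, Pi.smul_apply, smul_eq_mul, Finset.mul_sum]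
  refine Finset.sum_le_sum fun j _ => Finset.sum_le_sum fun k _ => ?_
  have := mul_le_mul_of_nonneg_left (hvw k) (mul_nonneg ((hQ i).nonneg j k) (hu j))
  simp only [Pi.smul_apply, smul_eq_mul] at this
  linarith

theorem eq_zero_of_bilinForm_le (hQ : HasSecondOrder f Q) {u : Fin n → ℝ} (hu : ∀ i, 0 < u i)
    {i : Fin n} (h : bilinForm Q u u i ≤ 0) (j k : Fin n) : Q i j k = 0 := by
  have hn : ∀ j k, 0 ≤ Q i j k * u j * u k := fun j k =>
    mul_nonneg (mul_nonneg ((hQ i).nonneg j k) (hu j).le) (hu k).le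
  have h1 : Q i j k * u j * u k ≤ bilinForm Q u u i :=
    (Finset.single_le_sum (f := fun k => Q i j k * u j * u k) (fun k _ => hn j k)
      (Finset.mem_univ k)).trans
      (Finset.single_le_sum (f := fun j => ∑ k, Q i j k * u j * u k)
        (fun j _ => Finset.sum_nonneg fun k _ => hn j k) (Finset.mem_univ j))
  have h2 : Q i j k * u j * u k = 0 := le_antisymm (h1.trans h) (hn j k)
  simpa [(hu j).ne', (hu k).ne'] using h2

end HasSecondOrder

/-- Replaces the inverse by the linear equation for the increment, the only form used afterwards. -/
theorem newtonOp_spec {f : PolySystem n} {x : Fin n → ℝ} (h : IsInverseNonneg (jacobian f x)) :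
    ∃ δ, newtonOp f x = x + δ ∧ δ = value f x - x + (jacobian f x).mulVec δ := by
  refine ⟨_, rfl, ?_⟩
  have : (1 - jacobian f x).mulVec ((1 - jacobian f x)⁻¹.mulVec (value f x - x)) =
      value f x - x := by
    rw [Matrix.mulVec_mulVec, Matrix.mul_nonsing_inv _ h.isUnit_det, Matrix.one_mulVec]
  rw [Matrix.sub_mulVec, Matrix.one_mulVec] at this
  exact sub_eq_iff_eq_add.1 this

/-! ### A single Newton step. -/

section Step

variable {f : PolySystem n} {Q : Fin n → Fin n → Fin n → ℝ} {x μ : Fin n → ℝ}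

/-- The increment satisfies δ - f'(x)δ = f(x) - x ≥ 0, so δ ≥ 0 and x + δ = f(x) + f'(x)δ ≥ f(x). -/
theorem value_le_newtonOp (hf : NonnegCoeffs f) (h : IsInverseNonneg (jacobian f x))
    (hx : 0 ≤ x) (hxf : x ≤ value f x) : value f x ≤ newtonOp f x := by
  obtain ⟨δ, hN, hδ⟩ := newtonOp_spec h
  have h0 : 0 ≤ δ := h _ fun i => by
    have := congrFun hδ i
    have := hxf i
    simp only [Pi.add_apply, Pi.sub_apply] at *
    linarith
  have h1 := mulVec_mono (jacobian_nonneg hf hx) h0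
  rw [Matrix.mulVec_zero] at h1
  intro i
  have := h1 i
  have := congrFun hδ i
  simp only [hN, Pi.add_apply, Pi.sub_apply, Pi.zero_apply] at *
  linarith

/-- Expanding at x gives f(x + δ) = x + δ + B(δ, δ). -/
theorem HasSecondOrder.newtonOp_le_value (hQ : HasSecondOrder f Q)
    (h : IsInverseNonneg (jacobian f x)) (hxf : x ≤ value f x) :
    newtonOp f x ≤ value f (newtonOp f x) := by
  obtain ⟨δ, hN, hδ⟩ := newtonOp_spec h
  have h0 : 0 ≤ δ := h _ fun i => by
    have := congrFun hδ i
    have := hxf i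
    simp only [Pi.add_apply, Pi.sub_apply] at *
    linarith
  rw [hN, hQ.value_add]
  intro i
  have := hQ.bilinForm_nonneg h0 h0 i
  have := congrFun hδ i
  simp only [Pi.add_apply, Pi.sub_apply, Pi.zero_apply] at *
  linarith

/-- The equation for the increment is subtracted from the expansion of f(μ) = μ at x; only the
quadratic term survives as a source. -/
theorem HasSecondOrder.sub_newtonOp_eq (hQ : HasSecondOrder f Q)
    (h : IsInverseNonneg (jacobian f x)) (hμ : value f μ = μ) :
    μ - newtonOp f x = (jacobian f x).mulVec (μ - newtonOp f x) +
      bilinForm Q (μ - x) (μ - x) := by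
  obtain ⟨δ, hN, hδ⟩ := newtonOp_spec h
  have h1 := hQ.value_add x (μ - x)
  rw [add_sub_cancel, hμ] at h1
  have h2 : μ - newtonOp f x = (μ - x) - δ := by rw [hN]; abel
  rw [h2, Matrix.mulVec_sub]
  funext i
  have h3 := congrFun h1 i
  have h4 := congrFun hδ i
  simp only [Pi.add_apply, Pi.sub_apply] at *
  linarith

theorem HasSecondOrder.newtonOp_le (hQ : HasSecondOrder f Q)
    (h : IsInverseNonneg (jacobian f x)) (hμ : value f μ = μ) (hxμ : x ≤ μ) :
    newtonOp f x ≤ μ := by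
  refine sub_nonneg.1 (h _ fun i => ?_)
  have h1 := congrFun (hQ.sub_newtonOp_eq h hμ) i
  have h2 := hQ.bilinForm_nonneg (sub_nonneg.2 hxμ) (sub_nonneg.2 hxμ) i
  rw [Pi.add_apply] at h1
  rw [h1]
  exact le_add_of_nonneg_right h2

/-- A Newton step halves the error measured along a cone vector of the Jacobian at `μ`. -/
theorem HasSecondOrder.sub_newtonOp_le (hQ : HasSecondOrder f Q)
    (h : IsInverseNonneg (jacobian f x)) (hμ : value f μ = μ) (hxμ : x ≤ μ) {d : Fin n → ℝ}
    (hd : (jacobian f μ).mulVec d ≤ d) {c : ℝ} (hc : 0 ≤ c) (hxd : μ - x ≤ c • d) :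
    μ - newtonOp f x ≤ (c / 2) • d := by
  -- It suffices that (c/2)(d - f'(x)d) ≥ B(μ - x, μ - x). By f'(x)d + 2B(μ - x, d) = f'(μ)d ≤ d the
  -- left side is at least c B(μ - x, d), which dominates the right side.
  refine sub_nonneg.1 (h _ ?_)
  have h1 := hQ.sub_newtonOp_eq h hμ
  have h2 := hQ.bilinForm_le_smul (sub_nonneg.2 hxμ) hxd
  have h3 := hQ.jacobian_add_mulVec x (μ - x) d
  rw [add_sub_cancel] at h3
  rw [Matrix.mulVec_sub, Matrix.mulVec_smul]
  intro i
  have h4 := congrFun h1 i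
  have h5 := h2 i
  have h6 := congrFun h3 i
  have h7 := mul_le_mul_of_nonneg_left (hd i) hc
  simp only [Pi.add_apply, Pi.sub_apply, Pi.smul_apply, smul_eq_mul] at *
  rw [h6] at h7
  linarith

end Step

theorem newton_succ (f : PolySystem n) (k : ℕ) : newton f (k + 1) = newtonOp f (newton f k) := by
  simp [newton, Function.iterate_succ_apply']

end MSP
-- Invertibility along the Newton sequence.
namespace MSP
variable {n : ℕ}

theorem IsMSP.lfp_mem {f : PolySystem n} (hf : IsMSP f) : lfp f ∈ fixedPoints f :=
  (lfp_isLeast hf.nonneg hf.feasible).1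

theorem IsMSP.lfp_pos {f : PolySystem n} (hf : IsMSP f) (i : Fin n) : 0 < lfp f i := by
  obtain ⟨k, hk⟩ := hf.clean i
  have h : ∀ k, 0 ≤ kleene f k ∧ kleene f k ≤ lfp f := by
    intro k
    induction k with
    | zero => exact ⟨le_refl _, hf.lfp_mem.1⟩
    | succ k ih =>
      rw [kleene_succ]
      refine ⟨value_nonneg hf.nonneg ih.1, ?_⟩
      have := value_mono hf.nonneg ih.1 ih.2
      rwa [hf.lfp_mem.2] at this
  exact hk.trans_le ((h k).2 i)

theorem DependsDirectly.jacobian_pos {f : PolySystem n} (hf : NonnegCoeffs f) (hq : Quadratic f)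
    {i l : Fin n} (h : DependsDirectly f i l) {x : Fin n → ℝ} (hx : ∀ j, 0 < x j) :
    0 < jacobian f x i l := by
  obtain ⟨j, -, hj⟩ := Finset.exists_min_image Finset.univ x ⟨i, Finset.mem_univ i⟩
  have hi : f i ≠ 0 := by
    intro h0
    exact h (by rw [h0, map_zero])
  refine lt_of_lt_of_le ?_ (cMin_mul_min_le_jacobian hf hq h (hx j).le
    fun l => hj l (Finset.mem_univ l))
  exact mul_pos (cMin_pos hf hi) (lt_min (hx j) one_pos)

/-- An index without dependences is closed under dependence, hence the only index. For n = 1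
reflexivity alone gives strong connectivity, even for a constant f. -/
theorem StronglyConnected.exists_dependsDirectly {f : PolySystem n} (hsc : StronglyConnected f)
    (hn : n ≠ 1) (i : Fin n) : ∃ l, DependsDirectly f i l := by
  by_contra! h
  have h1 : ∀ l, l = i := by
    intro l
    refine hsc.forall_of_closed (p := fun l => l = i) ?_ rfl l
    rintro _ rfl l hl
    exact absurd hl (h l)
  have h2 : Subsingleton (Fin n) := ⟨fun a b => (h1 a).trans (h1 b).symm⟩
  have := Fin.subsingleton_iff_le_one.1 h2
  have := i.pos
  omega

section

variable {f : PolySystem n} {Q : Fin n → Fin n → Fin n → ℝ} {x : Fin n → ℝ}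

/-- The test vector is v = μ - x, with f'(x)v = v - (f(x) - x) - B(v, v) ≤ v. Equality in all rows
would make x a fixed point below μ. Equality in one row kills its quadratic part, so its derivatives
are those at μ. -/
theorem isInverseNonneg_jacobian_of_lt_lfp (hn : 0 < n) (hf : IsMSP f) (hq : Quadratic f)
    (hsc : StronglyConnected f) (hQ : HasSecondOrder f Q) (hx : 0 ≤ x) (hxf : x ≤ value f x)
    (hlt : ∀ i, x i < lfp f i) : IsInverseNonneg (jacobian f x) := by
  have h1 := hQ.value_add x (lfp f - x)
  rw [add_sub_cancel, hf.lfp_mem.2] at h1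
  have hv : ∀ i, 0 < (lfp f - x) i := fun i => sub_pos.2 (hlt i)
  have hB := hQ.bilinForm_nonneg (u := lfp f - x) (v := lfp f - x)
    (fun i => (hv i).le) (fun i => (hv i).le)
  refine hsc.isInverseNonneg (jacobian_nonneg hf.nonneg hx) hv ?_ ?_ ?_
  · intro i
    have := congrFun h1 i
    have := hxf i
    have := hB i
    simp only [Pi.add_apply, Pi.sub_apply, Pi.zero_apply] at *
    linarith
  · intro heq
    have hfix : value f x = x := by
      funext i
      have := congrFun h1 i
      have := congrFun heq i
      have := hxf i
      have := hB i
      simp only [Pi.add_apply, Pi.sub_apply, Pi.zero_apply] at *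
      linarith
    exact absurd ((lfp_isLeast hf.nonneg hf.feasible).2 ⟨hx, hfix⟩ ⟨0, hn⟩) (hlt _).not_ge
  · intro i hi l hl
    have h0 : bilinForm Q (lfp f - x) (lfp f - x) i ≤ 0 := by
      have := congrFun h1 i
      have := hxf i
      simp only [Pi.add_apply, Pi.sub_apply] at *
      linarith
    rw [hQ.jacobian_eq_of_eq_zero (hQ.eq_zero_of_bilinForm_le hv h0) x (lfp f)]
    exact hl.jacobian_pos hf.nonneg hq hf.lfp_pos

/-- The properties of the Newton iterates that make the next Newton step well defined. -/
structure IsNewtonPoint (f : PolySystem n) (Q : Fin n → Fin n → Fin n → ℝ) (x : Fin n → ℝ) :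
    Prop where
  nonneg : 0 ≤ x
  le_value : x ≤ value f x
  le_lfp : x ≤ lfp f
  affine_or_lt : (∀ i j k, Q i j k = 0) ∨ ∀ i, x i < lfp f i

theorem isNewtonPoint_zero (hf : IsMSP f) : IsNewtonPoint f Q 0 :=
  ⟨le_rfl, value_nonneg hf.nonneg le_rfl, hf.lfp_mem.1, Or.inr hf.lfp_pos⟩

/-- For affine f the first step already reaches μ and strictness is lost, but the Jacobian is
constant and can be taken at 0. -/
theorem IsNewtonPoint.isInverseNonneg (h : IsNewtonPoint f Q x) (hn : 0 < n) (hf : IsMSP f)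
    (hq : Quadratic f) (hsc : StronglyConnected f) (hQ : HasSecondOrder f Q) :
    IsInverseNonneg (jacobian f x) := by
  rcases h.affine_or_lt with h0 | hlt
  · have : jacobian f x = jacobian f 0 := by
      ext i l
      exact hQ.jacobian_eq_of_eq_zero (h0 i) x 0 l
    rw [this]
    exact isInverseNonneg_jacobian_of_lt_lfp hn hf hq hsc hQ le_rfl
      (value_nonneg hf.nonneg le_rfl) hf.lfp_pos
  · exact isInverseNonneg_jacobian_of_lt_lfp hn hf hq hsc hQ h.nonneg h.le_value hlt

/-- For strictness, the new error y satisfies y = f'(x)y + B(μ - x, μ - x). A zero of y makes its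
row affine, so irreducibility applies: either y > 0, or y = 0 and every row is affine. -/
theorem IsNewtonPoint.newtonOp (h : IsNewtonPoint f Q x) (hn : 0 < n) (hf : IsMSP f)
    (hq : Quadratic f) (hsc : StronglyConnected f) (hQ : HasSecondOrder f Q) :
    IsNewtonPoint f Q (newtonOp f x) := by
  have hi := h.isInverseNonneg hn hf hq hsc hQ
  have hle := hQ.newtonOp_le hi hf.lfp_mem.2 h.le_lfp
  refine ⟨(value_nonneg hf.nonneg h.nonneg).trans
    (value_le_newtonOp hf.nonneg hi h.nonneg h.le_value),
    hQ.newtonOp_le_value hi h.le_value, hle, ?_⟩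
  rcases h.affine_or_lt with h0 | hlt
  · exact Or.inl h0
  have hv : ∀ i, 0 < (lfp f - x) i := fun i => sub_pos.2 (hlt i)
  have hB := hQ.bilinForm_nonneg (u := lfp f - x) (v := lfp f - x)
    (fun i => (hv i).le) (fun i => (hv i).le)
  have hy := sub_nonneg.2 hle
  have heq := hQ.sub_newtonOp_eq hi hf.lfp_mem.2
  have hJ := mulVec_mono (jacobian_nonneg hf.nonneg h.nonneg) hy
  rw [Matrix.mulVec_zero] at hJ
  have hzero : ∀ i, (lfp f - MSP.newtonOp f x) i = 0 → ∀ j k, Q i j k = 0 := by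
    intro i hi0
    refine hQ.eq_zero_of_bilinForm_le hv ?_
    have h1 := congrFun heq i
    have h2 := hJ i
    rw [hi0, Pi.add_apply] at h1
    rw [Pi.zero_apply] at h2
    linarith
  have hJy : (jacobian f x).mulVec (lfp f - MSP.newtonOp f x) ≤ lfp f - MSP.newtonOp f x := by
    intro i
    have h1 := congrFun heq i
    rw [Pi.add_apply] at h1
    rw [h1]
    exact le_add_of_nonneg_right (hB i)
  have hdep : ∀ i, (lfp f - MSP.newtonOp f x) i = 0 →
      ∀ l, DependsDirectly f i l → 0 < jacobian f x i l := by
    intro i hi0 l hl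
    rw [hQ.jacobian_eq_of_eq_zero (hzero i hi0) x (lfp f)]
    exact hl.jacobian_pos hf.nonneg hq hf.lfp_pos
  rcases hsc.pos_or_eq_zero (jacobian_nonneg hf.nonneg h.nonneg) hy hJy hdep with h1 | h1
  · exact Or.inr fun i => sub_pos.1 (h1 i)
  · exact Or.inl fun i => hzero i (congrFun h1 i)

theorem isNewtonPoint_newton (hn : 0 < n) (hf : IsMSP f) (hq : Quadratic f)
    (hsc : StronglyConnected f) (hQ : HasSecondOrder f Q) (k : ℕ) :
    IsNewtonPoint f Q (newton f k) := by
  induction k with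
  | zero => exact isNewtonPoint_zero hf
  | succ k ih =>
    rw [newton_succ]
    exact ih.newtonOp hn hf hq hsc hQ

/-! ### Convergence, and a cone vector at the least fixed point. -/

theorem continuous_value (f : PolySystem n) : Continuous (value f) :=
  continuous_pi fun i => MvPolynomial.continuous_eval (f i)

-- The sandwich ν^(k) ≤ f(ν^(k)) ≤ ν^(k+1) makes the limit a fixed point; it lies below μ, so it is
-- μ.
open Filter Topology in
theorem tendsto_newton (hn : 0 < n) (hf : IsMSP f) (hq : Quadratic f)
    (hsc : StronglyConnected f) : Tendsto (newton f) atTop (𝓝 (lfp f)) := by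
  obtain ⟨Q, hQ⟩ := exists_hasSecondOrder hf.nonneg hq
  have hp := isNewtonPoint_newton hn hf hq hsc hQ
  have hstep : ∀ k, value f (newton f k) ≤ newton f (k + 1) := by
    intro k
    rw [newton_succ]
    exact value_le_newtonOp hf.nonneg ((hp k).isInverseNonneg hn hf hq hsc hQ) (hp k).nonneg
      (hp k).le_value
  have hm : Monotone (newton f) :=
    monotone_nat_of_le_succ fun k => (hp k).le_value.trans (hstep k)
  have hb : BddAbove (Set.range (newton f)) :=
    ⟨lfp f, by rintro _ ⟨k, rfl⟩; exact (hp k).le_lfp⟩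
  have ht := tendsto_atTop_ciSup hm hb
  have htf := ((continuous_value f).tendsto _).comp ht
  have hfix : value f (⨆ k, newton f k) = ⨆ k, newton f k :=
    le_antisymm
      (le_of_tendsto_of_tendsto' htf ((tendsto_add_atTop_iff_nat 1).2 ht) hstep)
      (le_of_tendsto_of_tendsto' ht htf fun k => (hp k).le_value)
  have : ⨆ k, newton f k = lfp f :=
    le_antisymm (ciSup_le fun k => (hp k).le_lfp)
      ((lfp_isLeast hf.nonneg hf.feasible).2 ⟨(hp 0).nonneg.trans (le_ciSup hb 0), hfix⟩)
  rwa [this] at ht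

theorem IsNewtonPoint.jacobian_mulVec_sub_le (h : IsNewtonPoint f Q x) (hf : IsMSP f)
    (hQ : HasSecondOrder f Q) : (jacobian f x).mulVec (lfp f - x) ≤ lfp f - x := by
  have h1 := hQ.value_add x (lfp f - x)
  rw [add_sub_cancel, hf.lfp_mem.2] at h1
  have hB := hQ.bilinForm_nonneg (sub_nonneg.2 h.le_lfp) (sub_nonneg.2 h.le_lfp)
  intro i
  have := congrFun h1 i
  have := h.le_value i
  have := hB i
  simp only [Pi.add_apply, Pi.sub_apply, Pi.zero_apply] at *
  linarith

open Filter Topology in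
/-- The Jacobian at the least fixed point has a positive cone vector. -/
theorem exists_cone_vector (hn : 0 < n) (hf : IsMSP f) (hq : Quadratic f)
    (hsc : StronglyConnected f) :
    ∃ d : Fin n → ℝ, (∀ i, 0 < d i) ∧ (jacobian f (lfp f)).mulVec d ≤ d := by
  obtain ⟨Q, hQ⟩ := exists_hasSecondOrder hf.nonneg hq
  have hp := isNewtonPoint_newton hn hf hq hsc hQ
  by_cases h0 : ∀ i j k, Q i j k = 0
  -- In the affine case the error at 0, which is μ itself, is a cone vector of the constant
  -- Jacobian.
  · refine ⟨lfp f, hf.lfp_pos, ?_⟩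
    have h1 : jacobian f (lfp f) = jacobian f 0 := by
      ext i l
      exact hQ.jacobian_eq_of_eq_zero (h0 i) _ _ l
    have := (isNewtonPoint_zero (Q := Q) hf).jacobian_mulVec_sub_le hf hQ
    rwa [h1, ← sub_zero (lfp f)]
  have hlt : ∀ k i, newton f k i < lfp f i := fun k => (hp k).affine_or_lt.resolve_left h0
  -- Each error is a cone vector of the Jacobian at its iterate. Normalised, the errors have a limit
  -- point on the unit sphere, and the inequality passes to the limit.
  let u : ℕ → Fin n → ℝ := fun k => ‖lfp f - newton f k‖⁻¹ • (lfp f - newton f k)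
  have hne : ∀ k, lfp f - newton f k ≠ 0 := fun k hk =>
    (sub_pos.2 (hlt k ⟨0, hn⟩)).ne' (congrFun hk ⟨0, hn⟩)
  have hu1 : ∀ k, u k ∈ Metric.sphere (0 : Fin n → ℝ) 1 := by
    intro k
    rw [mem_sphere_zero_iff_norm, norm_smul, norm_inv, norm_norm,
      inv_mul_cancel₀ (norm_ne_zero_iff.2 (hne k))]
  have hu0 : ∀ k, 0 ≤ u k := fun k =>
    smul_nonneg (inv_nonneg.2 (norm_nonneg _)) (sub_nonneg.2 (hp k).le_lfp)
  have huJ : ∀ k, (jacobian f (newton f k)).mulVec (u k) ≤ u k := by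
    intro k
    rw [Matrix.mulVec_smul]
    exact smul_le_smul_of_nonneg_left ((hp k).jacobian_mulVec_sub_le hf hQ)
      (inv_nonneg.2 (norm_nonneg _))
  obtain ⟨d, hd1, φ, hφ, hd⟩ := (isCompact_sphere (0 : Fin n → ℝ) 1).tendsto_subseq hu1
  have hd0 : 0 ≤ d := ge_of_tendsto' hd fun k => hu0 _
  have hdJ : (jacobian f (lfp f)).mulVec d ≤ d := by
    have hc : Continuous fun p : (Fin n → ℝ) × (Fin n → ℝ) => (jacobian f p.1).mulVec p.2 := by
      refine continuous_pi fun i => ?_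
      simp only [Matrix.mulVec, dotProduct, jacobian, Matrix.of_apply]
      refine continuous_finsetSum _ fun j _ => ?_
      exact ((MvPolynomial.continuous_eval _).comp continuous_fst).mul
        ((continuous_apply j).comp continuous_snd)
    have ht := (hc.tendsto (lfp f, d)).comp
      (((tendsto_newton hn hf hq hsc).comp hφ.tendsto_atTop).prodMk_nhds hd)
    exact le_of_tendsto_of_tendsto' ht hd fun k => huJ _
  refine ⟨d, ?_, hdJ⟩
  refine (hsc.pos_or_eq_zero (jacobian_nonneg hf.nonneg hf.lfp_mem.1) hd0 hdJ
    fun i _ l hl => hl.jacobian_pos hf.nonneg hq hf.lfp_pos).resolve_right ?_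
  rintro rfl
  simp at hd1

/-! ### Decay of the error and size of the initial constant. -/

theorem sub_newton_le (hn : 0 < n) (hf : IsMSP f) (hq : Quadratic f)
    (hsc : StronglyConnected f) {d : Fin n → ℝ} (hd : (jacobian f (lfp f)).mulVec d ≤ d) {c : ℝ}
    (hc : 0 ≤ c) (hcd : lfp f ≤ c • d) (k : ℕ) :
    lfp f - newton f k ≤ (c / 2 ^ k) • d := by
  obtain ⟨Q, hQ⟩ := exists_hasSecondOrder hf.nonneg hq
  have hp := isNewtonPoint_newton hn hf hq hsc hQ
  induction k with
  | zero => simpa [newton] using hcd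
  | succ k ih =>
    rw [newton_succ, pow_succ, ← div_div]
    exact hQ.sub_newtonOp_le ((hp k).isInverseNonneg hn hf hq hsc hQ) hf.lfp_mem.2
      (hp k).le_lfp hd (by positivity) ih

end

/-- The components of a positive supersolution of an irreducible system differ at most by the
factor `q ^ (n - 1)`, where `q` bounds the nonzero entries of the matrix from below. -/
theorem StronglyConnected.pow_mul_le {f : PolySystem n} (hsc : StronglyConnected f)
    {d : Fin n → ℝ} (hd : ∀ i, 0 < d i) {q : ℝ} (hq0 : 0 < q) (hq1 : q ≤ 1)
    (hdep : ∀ i l, DependsDirectly f i l → q * d l ≤ d i) (i j : Fin n) :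
    q ^ (n - 1) * d j ≤ d i := by
  classical
  -- The set of l with q^k d_l ≤ d_i contains i for k = 0 and gains an index with each k until it is
  -- full, at the latest for k = n - 1.
  have key : ∀ k, min (k + 1) n ≤ (Finset.univ.filter fun l => q ^ k * d l ≤ d i).card := by
    intro k
    induction k with
    | zero =>
      refine (min_le_left _ _).trans (Finset.one_le_card.2 ⟨i, ?_⟩)
      simp
    | succ k ih =>
      have hsub : (Finset.univ.filter fun l => q ^ k * d l ≤ d i) ⊆
          Finset.univ.filter fun l => q ^ (k + 1) * d l ≤ d i := by
        intro l
        simp only [Finset.mem_filter, Finset.mem_univ, true_and]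
        refine fun h => le_trans (mul_le_mul_of_nonneg_right ?_ (hd l).le) h
        exact pow_le_pow_of_le_one hq0.le hq1 (Nat.le_succ k)
      by_cases hall : ∀ l, q ^ k * d l ≤ d i
      · have : (Finset.univ.filter fun l => q ^ (k + 1) * d l ≤ d i) = Finset.univ :=
          Finset.eq_univ_of_forall fun l => hsub (by simpa using hall l)
        rw [this, Finset.card_univ, Fintype.card_fin]
        exact min_le_right _ _
      -- By strong connectivity some dependence leaves the set; it costs one more factor q.
      · obtain ⟨a, ha, b, hab, hb⟩ : ∃ a, q ^ k * d a ≤ d i ∧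
            ∃ b, DependsDirectly f a b ∧ ¬ q ^ k * d b ≤ d i := by
          by_contra! h
          refine hall (hsc.forall_of_closed (p := fun l => q ^ k * d l ≤ d i) h (i := i) ?_)
          exact mul_le_of_le_one_left (hd i).le (pow_le_one₀ hq0.le hq1)
        have hlt : (Finset.univ.filter fun l => q ^ k * d l ≤ d i).card <
            (Finset.univ.filter fun l => q ^ (k + 1) * d l ≤ d i).card := by
          refine Finset.card_lt_card ((Finset.ssubset_iff_of_subset hsub).2 ⟨b, ?_, by simpa using hb⟩)
          simp only [Finset.mem_filter, Finset.mem_univ, true_and]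
          refine le_trans ?_ ha
          rw [pow_succ, mul_assoc]
          exact mul_le_mul_of_nonneg_left (hdep a b hab) (by positivity)
        omega
  have h1 := key (n - 1)
  have h2 : min (n - 1 + 1) n = n := by
    have := i.pos
    omega
  rw [h2] at h1
  have h3 : (Finset.univ.filter fun l => q ^ (n - 1) * d l ≤ d i) = Finset.univ := by
    refine Finset.eq_univ_of_card _ (le_antisymm (Finset.card_le_univ _) ?_)
    rwa [Fintype.card_fin]
  have h4 := Finset.mem_univ j
  rw [← h3] at h4
  exact (Finset.mem_filter.1 h4).2

/-- The initial error, measured along a cone vector, is at most `2 ^ ⌈threshold f⌉₊` times the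
least fixed point. -/
theorem lfp_mul_le_two_pow_mul {f : PolySystem n} (hf : IsMSP f) (hq : Quadratic f)
    (hsc : StronglyConnected f) {d : Fin n → ℝ} (hd : ∀ i, 0 < d i)
    (hdJ : (jacobian f (lfp f)).mulVec d ≤ d) (m j : Fin n) :
    lfp f m * d j ≤ 2 ^ ⌈threshold f⌉₊ * (lfp f j * d m) := by
  have hpos := hf.lfp_pos
  -- Here there may be no dependence and q may exceed 1, but m = j and the natural ceiling, cut off
  -- at 0, keeps the factor at least 1.
  by_cases hn : n = 1
  · subst hn
    obtain rfl := Subsingleton.elim m j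
    exact le_mul_of_one_le_left (mul_pos (hpos m) (hd m)).le (one_le_pow₀ one_le_two)
  have : Nonempty (Fin n) := ⟨m⟩
  have hmin : ∀ l, muMin f ≤ lfp f l := fun l => ciInf_le (Set.finite_range _).bddBelow l
  have hmax : ∀ l, lfp f l ≤ muMax f := fun l => le_ciSup (Set.finite_range _).bddAbove l
  have hmin0 : 0 < muMin f := by
    obtain ⟨l, hl⟩ := exists_eq_ciInf_of_finite (f := lfp f)
    exact (hpos l).trans_eq hl
  obtain ⟨l₀, hl₀⟩ := hsc.exists_dependsDirectly hn m
  have hc0 : 0 < cMin f := by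
    refine cMin_pos hf.nonneg (i := m) fun h0 => hl₀ ?_
    rw [h0, map_zero]
  set q := cMin f * min (muMin f) 1 with hq_def
  have hq0 : 0 < q := mul_pos hc0 (lt_min hmin0 one_pos)
  have hdep : ∀ i l, DependsDirectly f i l → q * d l ≤ d i := by
    intro i l hl
    refine le_trans ?_ (hdJ i)
    refine (mul_le_mul_of_nonneg_right
      (cMin_mul_min_le_jacobian hf.nonneg hq hl hmin0.le hmin) (hd l).le).trans ?_
    exact Finset.single_le_sum (f := fun l => jacobian f (lfp f) i l * d l)
      (fun l _ => mul_nonneg (jacobian_nonneg hf.nonneg hf.lfp_mem.1 i l) (hd l).le)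
      (Finset.mem_univ l)
  -- At a minimal component d_i, a dependence i → l gives q d_l ≤ d_i ≤ d_l.
  have hq1 : q ≤ 1 := by
    obtain ⟨i, -, hi⟩ := Finset.exists_min_image Finset.univ d Finset.univ_nonempty
    obtain ⟨l, hl⟩ := hsc.exists_dependsDirectly hn i
    by_contra! h
    have h1 := hdep i l hl
    have h2 := hi l (Finset.mem_univ l)
    have h3 := mul_lt_mul_of_pos_right h (hd l)
    linarith
  have hρ : 1 ≤ muMax f / muMin f := by
    rw [one_le_div hmin0]
    exact (hmin m).trans (hmax m)
  have hmax0 : 0 < muMax f := (hpos m).trans_le (hmax m)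
  have hpow : (muMax f / muMin f / q) ^ n ≤ 2 ^ ⌈threshold f⌉₊ := by
    have h1 : threshold f = n * Real.logb 2 (muMax f / muMin f / q) := by
      rw [threshold, div_div]
      congr 3
      rw [hq_def]
      ring
    have h2 : (2 : ℝ) ^ threshold f = (muMax f / muMin f / q) ^ n := by
      rw [h1, mul_comm, Real.rpow_mul two_pos.le, Real.rpow_logb two_pos (by norm_num)
        (by positivity), Real.rpow_natCast]
    rw [← h2, ← Real.rpow_natCast]
    exact Real.rpow_le_rpow_of_exponent_le one_le_two (Nat.le_ceil _)
  have hqn := hsc.pow_mul_le hd hq0 hq1 hdep m j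
  -- One factor μ_max/μ_min and n - 1 factors 1/q would suffice; as all of them are at least 1, the
  -- n-th power is a bound.
  have hpn : muMax f / muMin f / q ^ (n - 1) ≤ (muMax f / muMin f / q) ^ n := by
    rw [div_pow]
    have h1 : q ^ n ≤ q ^ (n - 1) := pow_le_pow_of_le_one hq0.le hq1 (Nat.sub_le n 1)
    have h2 := le_self_pow₀ hρ m.pos.ne'
    gcongr
  have h1 : lfp f m * d j ≤ muMax f / muMin f / q ^ (n - 1) * (lfp f j * d m) := by
    have h2 : d j ≤ d m / q ^ (n - 1) := by
      rw [le_div_iff₀ (by positivity), mul_comm]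
      exact hqn
    have h3 : lfp f m ≤ muMax f / muMin f * lfp f j := by
      rw [div_mul_eq_mul_div, le_div_iff₀ hmin0]
      exact mul_le_mul (hmax m) (hmin j) hmin0.le hmax0.le
    calc lfp f m * d j ≤ (muMax f / muMin f * lfp f j) * (d m / q ^ (n - 1)) :=
          mul_le_mul h3 h2 (hd j).le (mul_pos (by positivity) (hpos j)).le
      _ = _ := by ring
  exact h1.trans (mul_le_mul_of_nonneg_right (hpn.trans hpow) (mul_pos (hpos j) (hd m)).le)

end MSP

/-! ### Combination of the error bound with the initial constant. -/

theorem theorem3p2 {n : ℕ} (hn : 0 < n) (f : MSP.PolySystem n)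
    (hf : MSP.IsMSP f) (hquad : MSP.Quadratic f) (hsc : MSP.StronglyConnected f) :
    (∀ k : ℕ, IsUnit (1 - MSP.jacobian f (MSP.newton f k)).det) ∧
    ∀ i : ℕ, MSP.HasValidBits i (MSP.lfp f) (MSP.newton f (⌈MSP.threshold f⌉₊ + i)) := by
  obtain ⟨Q, hQ⟩ := MSP.exists_hasSecondOrder hf.nonneg hquad
  have hp := MSP.isNewtonPoint_newton hn hf hquad hsc hQ
  refine ⟨fun k => ((hp k).isInverseNonneg hn hf hquad hsc hQ).isUnit_det, fun i j => ?_⟩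
  obtain ⟨d, hd, hdJ⟩ := MSP.exists_cone_vector hn hf hquad hsc
  have hpos := hf.lfp_pos
  -- The maximal ratio is the least c with μ ≤ c d, the initial constant for the halving.
  obtain ⟨m, -, hm⟩ := Finset.exists_max_image Finset.univ (fun l => MSP.lfp f l / d l)
    ⟨⟨0, hn⟩, Finset.mem_univ _⟩
  have hc : 0 ≤ MSP.lfp f m / d m := (div_pos (hpos m) (hd m)).le
  have hcd : MSP.lfp f ≤ (MSP.lfp f m / d m) • d := fun l =>
    (div_le_iff₀ (hd l)).1 (hm l (Finset.mem_univ l))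
  have h1 := MSP.sub_newton_le hn hf hquad hsc hdJ hc hcd (⌈MSP.threshold f⌉₊ + i) j
  have h2 : MSP.lfp f m / d m * d j ≤ 2 ^ ⌈MSP.threshold f⌉₊ * MSP.lfp f j := by
    rw [div_mul_eq_mul_div, div_le_iff₀ (hd m), mul_assoc]
    exact MSP.lfp_mul_le_two_pow_mul hf hquad hsc hd hdJ m j
  rw [abs_of_nonneg (sub_nonneg.2 ((hp _).le_lfp j)), abs_of_pos (hpos j), div_le_iff₀ (hpos j),
    zpow_neg, zpow_natCast, inv_mul_eq_div]
  refine h1.trans ?_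
  rw [Pi.smul_apply, smul_eq_mul, pow_add, div_mul_eq_mul_div, ← div_div]
  refine div_le_div_of_nonneg_right ?_ (by positivity)
  rw [div_le_iff₀ (by positivity), mul_comm (MSP.lfp f j)]
  exact h2
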